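/- Let $B=\{u\in\mathbb{R}^3:\|u\|<1\}$ be the open unit ball with the Einstein addition $$u\oplus v=\frac{1}{1+u^Tv}\Big\{u+\frac{1}{\gamma_u}v+\frac{\gamma_u}{1+\gamma_u}(u^Tv)u\Big\},\qquad \gamma_u=\frac{1}{\sqrt{1-\|u\|^2}},$$ which is a binary operation on $B$, and let $d(u,v)=\tanh^{-1}\|(-u)\oplus v\|$ be the rapidity metric on $B$. For $v=(v_1,v_2,v_3)\in B$ let $$\rho_v=\frac12\begin{pmatrix}1+v_3&v_1-iv_2\\ v_1+iv_2&1-v_3\end{pmatrix}$$ be the qubit density matrix with Bloch vector $v$. For Hermitian positive definite complex $n\times n$ matrices $A,B'$ let the trace metric $\delta(A,B')$ be the infimum of the lengths $$L(\gamma)=\int_a^b\big\|\gamma(t)^{-1/2}\,\gamma'(t)\,\gamma(t)^{-1/2}\big\|_F\,dt\in[0,\infty]$$ over all differentiable paths $\gamma:[a,b]\to\{\text{Hermitian positive definite } n\times n \text{ matrices}\}$, $a<b$, with $\gamma(a)=A$ and $\gamma(b)=B'$, where $\|\cdot\|_F$ is the Frobenius norm. Then for all $u,v\in B$, $$d(u,v)\le\frac{1}{\sqrt2}\,\delta(\rho_u,\rho_v).$$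 -/

import Mathlib

open scoped MatrixOrder ComplexOrder ENNReal

noncomputable section

/-- Euclidean three-space `ℝ³`. -/
abbrev E3 : Type := EuclideanSpace ℝ (Fin 3)

/-- The open unit ball of `ℝ³`. -/
abbrev UnitBall3 : Type := Metric.ball (0 : E3) 1

/-- The Lorentz factor `γ_u = 1 / √(1 - ‖u‖²)`. -/
def lorentzFactor (u : E3) : ℝ := 1 / √(1 - ‖u‖ ^ 2)

/-- The Einstein velocity addition formula
`(1 + uᵀv)⁻¹ (u + γ_u⁻¹ v + γ_u (1 + γ_u)⁻¹ (uᵀv) u)`, as a vector of `ℝ³`. -/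
def einsteinAddVec (u v : E3) : E3 :=
  (1 / (1 + inner ℝ u v)) •
    (u + (1 / lorentzFactor u) • v +
      ((lorentzFactor u / (1 + lorentzFactor u)) * inner ℝ u v) • u)

/-- The open unit ball is closed under Einstein addition. -/
theorem einsteinAddVec_mem_ball (u v : UnitBall3) :
    einsteinAddVec u v ∈ Metric.ball (0 : E3) 1 := by
  obtain ⟨u, hu⟩ := u
  obtain ⟨v, hv⟩ := v
  rw [mem_ball_zero_iff] at hu hv ⊢
  change ‖einsteinAddVec u v‖ < 1
  have hu0 := norm_nonneg u
  have hv0 := norm_nonneg v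
  have hc : |inner ℝ u v| ≤ ‖u‖ * ‖v‖ := abs_real_inner_le_norm u v
  have h1 : 0 < 1 + inner ℝ u v := by
    have := (abs_le.mp hc).1
    nlinarith
  have hU : 0 < 1 - ‖u‖ ^ 2 := by nlinarith
  have hV : 0 < 1 - ‖v‖ ^ 2 := by nlinarith
  set s := √(1 - ‖u‖ ^ 2) with hs
  have hspos : 0 < s := Real.sqrt_pos.mpr hU
  have hs2 : s ^ 2 = 1 - ‖u‖ ^ 2 := Real.sq_sqrt hU.le
  have hvec : einsteinAddVec u v =
      (1 / (1 + inner ℝ u v)) • ((1 + inner ℝ u v / (1 + s)) • u + s • v) := by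
    have e1 : 1 / lorentzFactor u = s := by simp [lorentzFactor, hs]
    have e2 : lorentzFactor u / (1 + lorentzFactor u) * inner ℝ u v
        = inner ℝ u v / (1 + s) := by
      have : lorentzFactor u = 1 / s := rfl
      rw [this]
      field_simp
      ring
    rw [einsteinAddVec, e1, e2]
    module
  have hn : ‖(1 + inner ℝ u v / (1 + s)) • u + s • v‖ ^ 2
      = (1 + inner ℝ u v) ^ 2 - (1 - ‖u‖ ^ 2) * (1 - ‖v‖ ^ 2) := by
    rw [norm_add_sq_real, norm_smul, norm_smul, inner_smul_left, inner_smul_right,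
      mul_pow, mul_pow, Real.norm_eq_abs, Real.norm_eq_abs, sq_abs, sq_abs]
    have : ‖u‖ ^ 2 = 1 - s ^ 2 := by linarith
    rw [this]
    simp only [conj_trivial]
    field_simp
    ring
  have hlt : ‖(1 + inner ℝ u v / (1 + s)) • u + s • v‖ < 1 + inner ℝ u v := by
    apply lt_of_pow_lt_pow_left₀ 2 h1.le
    rw [hn]
    have := mul_pos hU hV
    linarith
  rw [hvec, norm_smul, Real.norm_of_nonneg (by positivity), one_div, inv_mul_lt_iff₀ h1]
  simpa using hlt

/-- Einstein addition, as a binary operation on the open unit ball. -/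
def einsteinAdd (u v : UnitBall3) : UnitBall3 :=
  ⟨einsteinAddVec u v, einsteinAddVec_mem_ball u v⟩

/-- The rapidity metric `d(u, v) = artanh ‖(-u) ⊕ v‖`. -/
def rapidityDist (u v : UnitBall3) : ℝ :=
  Real.artanh ‖(einsteinAdd (-u) v : E3)‖

/-- The qubit matrix `ρ_v` with Bloch vector `v`. -/
def qubit (v : E3) : Matrix (Fin 2) (Fin 2) ℂ :=
  (1 / 2 : ℂ) •
    !![1 + (v 2 : ℂ), (v 0 : ℂ) - Complex.I * (v 1 : ℂ);
       (v 0 : ℂ) + Complex.I * (v 1 : ℂ), 1 - (v 2 : ℂ)]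

section FrobeniusNorm

attribute [local instance] Matrix.frobeniusNormedAddCommGroup

/-- The Frobenius (Hilbert-Schmidt) norm of a complex matrix. -/
def frobeniusNorm {n : Type*} [Fintype n] (X : Matrix n n ℂ) : ℝ := ‖X‖

end FrobeniusNorm

/-- The length of the tangent vector `X` at the positive definite matrix `A` in the trace
metric: `‖A^{-1/2} X A^{-1/2}‖_F`. -/
def traceSpeed {n : Type*} [Fintype n] [DecidableEq n] (A X : Matrix n n ℂ) : ℝ :=
  frobeniusNorm ((CFC.sqrt A)⁻¹ * X * (CFC.sqrt A)⁻¹)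

/-- `γ`, restricted to `[a, b]`, is a differentiable path from `A` to `B` inside the cone of
Hermitian positive definite matrices. -/
structure IsPosDefPath {n : Type*} [Fintype n] [DecidableEq n] (A B : Matrix n n ℂ)
    (a b : ℝ) (γ : ℝ → Matrix n n ℂ) : Prop where
  lt : a < b
  posDef : ∀ t ∈ Set.Icc a b, (γ t).PosDef
  differentiableOn : DifferentiableOn ℝ γ (Set.Icc a b)
  source : γ a = A
  target : γ b = B

/-- The length of a path on `[a, b]`, with value `∞` if the speed is not integrable. -/
def traceLength {n : Type*} [Fintype n] [DecidableEq n]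
    (a b : ℝ) (γ : ℝ → Matrix n n ℂ) : ℝ≥0∞ :=
  ∫⁻ t in Set.Icc a b, ENNReal.ofReal (traceSpeed (γ t) (derivWithin γ (Set.Icc a b) t))

/-- The trace metric: the infimum of the lengths of the differentiable paths from `A` to `B`
inside the cone of Hermitian positive definite matrices. -/
def traceDist {n : Type*} [Fintype n] [DecidableEq n] (A B : Matrix n n ℂ) : ℝ :=
  (⨅ (a : ℝ) (b : ℝ) (γ : ℝ → Matrix n n ℂ) (_ : IsPosDefPath A B a b γ),
    traceLength a b γ).toReal

end

/-! For fixed nonzero `x`, `y`, follow `log (x* γ x) - log (y* γ y)` along a path `γ`. With `S =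
γ^{1/2}`, its derivative is the difference of two Rayleigh quotients of `Z = S⁻¹ γ' S⁻¹`, that is
`tr Z (pp* - qq*)` for unit vectors `p`, `q` along `S x`, `S y`. Since `‖pp* - qq*‖_F ≤ √2`,
Cauchy-Schwarz bounds it by `√2` times the speed (`re_quadForm_div_sub_le_traceSpeed`), and
integration gives `log_quadForm_sub_le_traceDist`.

Taking `x`, `y` to be generalized eigenvectors of `ρ_v` relative to `ρ_u` bounds the log-ratio of
the eigenvalues. Those are proportional to `1 ± r` with `r = ‖(-u) ⊕ v‖`, so the log-ratio is `2
artanh r = 2 d(u, v)`. -/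

/-! ### Frobenius norm and Rayleigh quotients -/

theorem frobeniusNorm_eq_sqrt {n : Type*} [Fintype n] (X : Matrix n n ℂ) :
    frobeniusNorm X = √(∑ i, ∑ j, ‖X i j‖ ^ 2) := by
  unfold frobeniusNorm
  rw [Matrix.frobenius_norm_def, Real.sqrt_eq_rpow]
  simp

theorem frobeniusNorm_nonneg {n : Type*} [Fintype n] (X : Matrix n n ℂ) :
    0 ≤ frobeniusNorm X := by
  rw [frobeniusNorm_eq_sqrt]; positivity

theorem frobeniusNorm_mul_le {n : Type*} [Fintype n] (X Y : Matrix n n ℂ) :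
    frobeniusNorm (X * Y) ≤ frobeniusNorm X * frobeniusNorm Y :=
  Matrix.frobenius_norm_mul X Y

/-- Expanding the squares gives `2 - 2 |⟨p, q⟩|²`. This is the source of the constant `√2`. -/
theorem sum_norm_sq_sub_rankOne_le {n : Type*} [Fintype n] (p q : n → ℂ)
    (hp : ∑ i, ‖p i‖ ^ 2 = 1) (hq : ∑ i, ‖q i‖ ^ 2 = 1) :
    ∑ i, ∑ j, ‖star (p i) * p j - star (q i) * q j‖ ^ 2 ≤ 2 := by
  have key (i j : n) : ‖star (p i) * p j - star (q i) * q j‖ ^ 2 =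
      ‖p i‖ ^ 2 * ‖p j‖ ^ 2 + ‖q i‖ ^ 2 * ‖q j‖ ^ 2
        - 2 * ((star (p i) * q i) * star (star (p j) * q j)).re := by
    simp only [Complex.sq_norm, Complex.normSq_apply, Complex.star_def, Complex.mul_re,
      Complex.mul_im, Complex.sub_re, Complex.sub_im, Complex.conj_re, Complex.conj_im]
    ring
  have hre : 0 ≤ ∑ i, ∑ j, ((star (p i) * q i) * star (star (p j) * q j)).re := by
    have : ∑ i, ∑ j, ((star (p i) * q i) * star (star (p j) * q j)).re
        = ‖∑ i, star (p i) * q i‖ ^ 2 := by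
      simp only [← Complex.re_sum, ← Finset.mul_sum, ← star_sum, ← Finset.sum_mul]
      rw [Complex.star_def, Complex.mul_conj, Complex.ofReal_re, Complex.normSq_eq_norm_sq]
    rw [this]; positivity
  simp only [key, Finset.sum_sub_distrib, Finset.sum_add_distrib, ← Finset.mul_sum,
    ← Finset.sum_mul, hp, hq]
  linarith

theorem re_quadForm_sub_le_of_unit {n : Type*} [Fintype n] (Z : Matrix n n ℂ) (p q : n → ℂ)
    (hp : ∑ i, ‖p i‖ ^ 2 = 1) (hq : ∑ i, ‖q i‖ ^ 2 = 1) :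
    (star p ⬝ᵥ Z.mulVec p).re - (star q ⬝ᵥ Z.mulVec q).re ≤ √2 * frobeniusNorm Z := by
  have h1 : (star p ⬝ᵥ Z.mulVec p) - (star q ⬝ᵥ Z.mulVec q)
      = ∑ x : n × n, Z x.1 x.2 * (star (p x.1) * p x.2 - star (q x.1) * q x.2) := by
    simp only [dotProduct, Matrix.mulVec, Finset.mul_sum, Fintype.sum_prod_type,
      ← Finset.sum_sub_distrib, Pi.star_apply]
    refine Finset.sum_congr rfl fun i _ => Finset.sum_congr rfl fun j _ => ?_
    ring
  rw [← Complex.sub_re, h1]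
  calc _ ≤ ∑ x : n × n, ‖Z x.1 x.2‖ * ‖star (p x.1) * p x.2 - star (q x.1) * q x.2‖ := by
        refine (Complex.re_le_norm _).trans ((norm_sum_le _ _).trans_eq ?_)
        simp only [norm_mul]
    _ ≤ √(∑ x : n × n, ‖Z x.1 x.2‖ ^ 2) *
          √(∑ x : n × n, ‖star (p x.1) * p x.2 - star (q x.1) * q x.2‖ ^ 2) :=
        Real.sum_mul_le_sqrt_mul_sqrt _ _ _
    _ ≤ √2 * frobeniusNorm Z := by
        rw [Fintype.sum_prod_type, Fintype.sum_prod_type, frobeniusNorm_eq_sqrt, mul_comm]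
        gcongr
        exact sum_norm_sq_sub_rankOne_le p q hp hq

theorem re_star_dotProduct_self {n : Type*} [Fintype n] (p : n → ℂ) :
    (star p ⬝ᵥ p).re = ∑ i, ‖p i‖ ^ 2 := by
  simp [dotProduct, Complex.sq_norm, Complex.normSq_apply]

theorem re_star_dotProduct_self_pos {n : Type*} [Fintype n] {p : n → ℂ} (hp : p ≠ 0) :
    0 < (star p ⬝ᵥ p).re :=
  (Complex.lt_def.1 (Matrix.dotProduct_star_self_pos_iff.2 hp)).1

theorem re_quadForm_smul {n : Type*} [Fintype n] (Z : Matrix n n ℂ) (p : n → ℂ) (c : ℝ) :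
    (star (c • p) ⬝ᵥ Z.mulVec (c • p)).re = c ^ 2 * (star p ⬝ᵥ Z.mulVec p).re := by
  rw [star_smul, Matrix.mulVec_smul, smul_dotProduct, dotProduct_smul]
  simp; ring

theorem re_rayleigh_sub_le {n : Type*} [Fintype n] [DecidableEq n] (Z : Matrix n n ℂ)
    {p q : n → ℂ} (hp : p ≠ 0) (hq : q ≠ 0) :
    (star p ⬝ᵥ Z.mulVec p).re / (star p ⬝ᵥ p).re - (star q ⬝ᵥ Z.mulVec q).re / (star q ⬝ᵥ q).re
      ≤ √2 * frobeniusNorm Z := by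
  have norm_one {r : n → ℂ} (hr : r ≠ 0) :
      ∑ i, ‖((√(star r ⬝ᵥ r).re)⁻¹ • r) i‖ ^ 2 = 1 := by
    have h := re_star_dotProduct_self_pos hr
    have h2 := re_quadForm_smul 1 r (√(star r ⬝ᵥ r).re)⁻¹
    rw [Matrix.one_mulVec, Matrix.one_mulVec] at h2
    rw [← re_star_dotProduct_self, h2, inv_pow, Real.sq_sqrt h.le, inv_mul_cancel₀ h.ne']
  have h := re_quadForm_sub_le_of_unit Z _ _ (norm_one hp) (norm_one hq)
  rw [re_quadForm_smul, re_quadForm_smul, inv_pow, inv_pow,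
    Real.sq_sqrt (re_star_dotProduct_self_pos hp).le,
    Real.sq_sqrt (re_star_dotProduct_self_pos hq).le] at h
  simpa only [div_eq_inv_mul] using h

/-! ### Square roots and the trace speed -/

theorem Matrix.PosDef.sqrt_mul_sqrt {n : Type*} [Fintype n] [DecidableEq n] {A : Matrix n n ℂ}
    (hA : A.PosDef) : CFC.sqrt A * CFC.sqrt A = A :=
  CFC.sqrt_mul_sqrt_self A hA.posSemidef.nonneg

theorem Matrix.conjTranspose_cfcSqrt {n : Type*} [Fintype n] [DecidableEq n] (A : Matrix n n ℂ) :
    (CFC.sqrt A).conjTranspose = CFC.sqrt A :=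
  (Matrix.nonneg_iff_posSemidef.1 (CFC.sqrt_nonneg A)).1

theorem Matrix.PosDef.isUnit_det_sqrt {n : Type*} [Fintype n] [DecidableEq n] {A : Matrix n n ℂ}
    (hA : A.PosDef) : IsUnit (CFC.sqrt A).det := by
  have h := (Matrix.isUnit_iff_isUnit_det _).1 hA.isUnit
  rw [← hA.sqrt_mul_sqrt, Matrix.det_mul] at h
  exact isUnit_of_mul_isUnit_left h

/-- The substitution `p = A^{1/2} x` turns quotients relative to `A` into ordinary Rayleigh
quotients of `A^{-1/2} Y A^{-1/2}`. -/
theorem re_quadForm_div_sub_le_traceSpeed {n : Type*} [Fintype n] [DecidableEq n]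
    {A : Matrix n n ℂ} (hA : A.PosDef) (Y : Matrix n n ℂ) {x y : n → ℂ} (hx : x ≠ 0)
    (hy : y ≠ 0) :
    (star x ⬝ᵥ Y.mulVec x).re / (star x ⬝ᵥ A.mulVec x).re
      - (star y ⬝ᵥ Y.mulVec y).re / (star y ⬝ᵥ A.mulVec y).re ≤ √2 * traceSpeed A Y := by
  set S := CFC.sqrt A with hS
  have hu : IsUnit S.det := hA.isUnit_det_sqrt
  have hSS : S * S = A := hA.sqrt_mul_sqrt
  have hne {z : n → ℂ} (hz : z ≠ 0) : S.mulVec z ≠ 0 := fun h =>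
    hz (Matrix.eq_zero_of_mulVec_eq_zero hu.ne_zero h)
  have hform (M : Matrix n n ℂ) (z : n → ℂ) :
      star (S.mulVec z) ⬝ᵥ M.mulVec (S.mulVec z) = star z ⬝ᵥ (S * M * S).mulVec z := by
    rw [Matrix.star_mulVec, Matrix.conjTranspose_cfcSqrt, Matrix.dotProduct_mulVec,
      Matrix.vecMul_vecMul, ← hS, ← Matrix.dotProduct_mulVec, Matrix.mulVec_mulVec]
  have h1 : S * (S⁻¹ * Y * S⁻¹) * S = Y := by
    rw [← mul_assoc, ← mul_assoc, Matrix.mul_nonsing_inv _ hu, one_mul, mul_assoc,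
      Matrix.nonsing_inv_mul _ hu, mul_one]
  have hself (z : n → ℂ) : star (S.mulVec z) ⬝ᵥ S.mulVec z = star z ⬝ᵥ A.mulVec z := by
    have := hform 1 z
    rwa [Matrix.one_mulVec, mul_one, hSS] at this
  have h := re_rayleigh_sub_le (S⁻¹ * Y * S⁻¹) (hne hx) (hne hy)
  rwa [hform, hform, h1, hself, hself] at h

/-! ### Growth of quadratic forms along a path -/

theorem Matrix.PosDef.re_quadForm_pos {n : Type*} [Fintype n] {A : Matrix n n ℂ}
    (hA : A.PosDef) {x : n → ℂ} (hx : x ≠ 0) : 0 < (star x ⬝ᵥ A.mulVec x).re :=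
  (Complex.lt_def.1 (hA.dotProduct_mulVec_pos hx)).1

/-- If `f` has speed at most `s`, then its increment is at most the lower integral of `s`. -/
theorem ofReal_sub_le_lintegral_of_deriv_le {a b : ℝ} (hab : a ≤ b) {f s : ℝ → ℝ}
    (hc : ContinuousOn f (Set.Icc a b))
    (hd : ∀ t ∈ Set.Ioo a b, DifferentiableAt ℝ f t)
    (hs : ∀ t ∈ Set.Ioo a b, deriv f t ≤ s t) :
    ENNReal.ofReal (f b - f a) ≤ ∫⁻ t in Set.Icc a b, ENNReal.ofReal (s t) := by
  -- Nothing is known about the measurability of `s`, whereas `deriv f` is always measurable.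
  have hle : ∫⁻ t in Set.Icc a b, ENNReal.ofReal (deriv f t)
      ≤ ∫⁻ t in Set.Icc a b, ENNReal.ofReal (s t) := by
    rw [MeasureTheory.setLIntegral_congr MeasureTheory.Ioo_ae_eq_Icc.symm,
      MeasureTheory.setLIntegral_congr (f := fun t => ENNReal.ofReal (s t))
        MeasureTheory.Ioo_ae_eq_Icc.symm]
    exact MeasureTheory.setLIntegral_mono' measurableSet_Ioo
      fun t ht => ENNReal.ofReal_le_ofReal (hs t ht)
  refine le_trans ?_ hle
  set I := ∫⁻ t in Set.Icc a b, ENNReal.ofReal (deriv f t) with hI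
  rcases eq_or_ne I ∞ with h | h
  · simp [h]
  -- A one-sided fundamental theorem of calculus only needs an integrable majorant of the
  -- derivative. The positive part is one, and `ENNReal.ofReal` does not distinguish it from the
  -- derivative.
  have hm : Measurable fun t => max (deriv f t) 0 := (measurable_deriv f).max measurable_const
  have hof (t : ℝ) : ENNReal.ofReal (max (deriv f t) 0) = ENNReal.ofReal (deriv f t) := by
    rcases le_total (deriv f t) 0 with h | h <;> simp [h]
  have hint : MeasureTheory.IntegrableOn (fun t => max (deriv f t) 0) (Set.Icc a b) := by
    refine (MeasureTheory.lintegral_ofReal_ne_top_iff_integrable hm.aestronglyMeasurable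
      (.of_forall fun t => le_max_right _ _)).1 ?_
    simpa only [hof] using h
  have := intervalIntegral.sub_le_integral_of_hasDeriv_right_of_le hab hc
    (fun t ht => (hd t ht).hasDerivAt.hasDerivWithinAt) hint (fun t _ => le_max_left _ _)
  rw [intervalIntegral.integral_of_le hab, ← MeasureTheory.integral_Icc_eq_integral_Ioc,
    MeasureTheory.integral_eq_lintegral_of_nonneg_ae
      (f := fun t => max (deriv f t) 0) (.of_forall fun t => le_max_right _ _)
      hm.aestronglyMeasurable] at this
  simp only [hof] at this
  exact ENNReal.ofReal_le_of_le_toReal this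

theorem DifferentiableWithinAt.hasDerivWithinAt_re_quadForm {n : Type*} [Fintype n]
    {γ : ℝ → Matrix n n ℂ} {s : Set ℝ} {t : ℝ} (h : DifferentiableWithinAt ℝ γ s t)
    (x : n → ℂ) :
    HasDerivWithinAt (fun t => (star x ⬝ᵥ (γ t).mulVec x).re)
      (star x ⬝ᵥ (derivWithin γ s t).mulVec x).re s t := by
  let _ : NormedAddCommGroup (Matrix n n ℂ) := Matrix.normedAddCommGroup
  let _ : NormedSpace ℝ (Matrix n n ℂ) := Matrix.normedSpace
  let l : Matrix n n ℂ →ₗ[ℝ] ℝ :=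
    { toFun := fun M => (star x ⬝ᵥ M.mulVec x).re
      map_add' := fun M N => by simp [Matrix.add_mulVec]
      map_smul' := fun c M => by simp [Matrix.smul_mulVec] }
  exact (LinearMap.toContinuousLinearMap l).hasFDerivAt.comp_hasDerivWithinAt t
    (DifferentiableWithinAt.hasDerivWithinAt h)

/-- Along a path of positive definite matrices, the logarithm of the quotient of the quadratic
forms of two fixed vectors grows at most `√2` times as fast as the length. -/
theorem IsPosDefPath.log_quadForm_sub_le {n : Type*} [Fintype n] [DecidableEq n]
    {A B : Matrix n n ℂ} {a b : ℝ} {γ : ℝ → Matrix n n ℂ} (h : IsPosDefPath A B a b γ)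
    {x y : n → ℂ} (hx : x ≠ 0) (hy : y ≠ 0) :
    ENNReal.ofReal
      ((Real.log (star x ⬝ᵥ B.mulVec x).re - Real.log (star y ⬝ᵥ B.mulVec y).re)
        - (Real.log (star x ⬝ᵥ A.mulVec x).re - Real.log (star y ⬝ᵥ A.mulVec y).re))
      ≤ ENNReal.ofReal √2 * traceLength a b γ := by
  set F : ℝ → ℝ := fun t =>
    Real.log (star x ⬝ᵥ (γ t).mulVec x).re - Real.log (star y ⬝ᵥ (γ t).mulVec y).re with hF
  set γ' := fun t => derivWithin γ (Set.Icc a b) t with hγ'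
  have hderiv (t : ℝ) (ht : t ∈ Set.Icc a b) : HasDerivWithinAt F
      ((star x ⬝ᵥ (γ' t).mulVec x).re / (star x ⬝ᵥ (γ t).mulVec x).re
        - (star y ⬝ᵥ (γ' t).mulVec y).re / (star y ⬝ᵥ (γ t).mulVec y).re) (Set.Icc a b) t := by
    have hd := h.differentiableOn t ht
    exact ((hd.hasDerivWithinAt_re_quadForm x).log ((h.posDef t ht).re_quadForm_pos hx).ne').sub
      ((hd.hasDerivWithinAt_re_quadForm y).log ((h.posDef t ht).re_quadForm_pos hy).ne')
  have hderivAt (t : ℝ) (ht : t ∈ Set.Ioo a b) :=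
    (hderiv t (Set.Ioo_subset_Icc_self ht)).hasDerivAt (Icc_mem_nhds ht.1 ht.2)
  have hend : F b - F a =
      ((Real.log (star x ⬝ᵥ B.mulVec x).re - Real.log (star y ⬝ᵥ B.mulVec y).re)
        - (Real.log (star x ⬝ᵥ A.mulVec x).re - Real.log (star y ⬝ᵥ A.mulVec y).re)) := by
    simp only [hF, h.source, h.target]
  rw [← hend]
  refine (ofReal_sub_le_lintegral_of_deriv_le (s := fun t => √2 * traceSpeed (γ t) (γ' t))
    h.lt.le (fun t ht => (hderiv t ht).continuousWithinAt)
    (fun t ht => (hderivAt t ht).differentiableAt) fun t ht => ?_).trans_eq ?_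
  · rw [(hderivAt t ht).deriv]
    exact re_quadForm_div_sub_le_traceSpeed (h.posDef t (Set.Ioo_subset_Icc_self ht)) _ hx hy
  · simp only [ENNReal.ofReal_mul (Real.sqrt_nonneg 2)]
    rw [MeasureTheory.lintegral_const_mul' _ _ ENNReal.ofReal_ne_top]
    rfl

/-! ### Finiteness of the trace distance -/

theorem frobeniusNorm_inv_sqrt_sq {n : Type*} [Fintype n] [DecidableEq n] {A : Matrix n n ℂ}
    (hA : A.PosDef) : frobeniusNorm (CFC.sqrt A)⁻¹ ^ 2 = (A⁻¹).trace.re := by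
  have hherm : ((CFC.sqrt A)⁻¹).conjTranspose = (CFC.sqrt A)⁻¹ := by
    rw [Matrix.conjTranspose_nonsing_inv, Matrix.conjTranspose_cfcSqrt]
  have hinv : A⁻¹ = ((CFC.sqrt A)⁻¹).conjTranspose * (CFC.sqrt A)⁻¹ := by
    rw [hherm, ← Matrix.mul_inv_rev, hA.sqrt_mul_sqrt]
  rw [frobeniusNorm_eq_sqrt, Real.sq_sqrt (by positivity), hinv, Finset.sum_comm]
  simp [Matrix.trace, Matrix.mul_apply, Complex.sq_norm, Complex.normSq_apply]

/-- A crude bound, but continuous in `A` without any study of the square root, hence bounded along a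
segment. -/
theorem traceSpeed_le {n : Type*} [Fintype n] [DecidableEq n] {A : Matrix n n ℂ}
    (hA : A.PosDef) (Y : Matrix n n ℂ) :
    traceSpeed A Y ≤ (A⁻¹).trace.re * frobeniusNorm Y := by
  rw [← frobeniusNorm_inv_sqrt_sq hA, traceSpeed]
  calc _ ≤ frobeniusNorm ((CFC.sqrt A)⁻¹ * Y) * frobeniusNorm (CFC.sqrt A)⁻¹ :=
        frobeniusNorm_mul_le _ _
    _ ≤ (frobeniusNorm (CFC.sqrt A)⁻¹ * frobeniusNorm Y) * frobeniusNorm (CFC.sqrt A)⁻¹ := by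
        gcongr
        · exact frobeniusNorm_nonneg _
        · exact frobeniusNorm_mul_le _ _
    _ = _ := by ring

theorem Matrix.PosDef.lineMap {n : Type*} [Fintype n] {A B : Matrix n n ℂ} (hA : A.PosDef)
    (hB : B.PosDef) {t : ℝ} (ht : t ∈ Set.Icc (0 : ℝ) 1) : (A + t • (B - A)).PosDef := by
  have h : A + t • (B - A) = (1 - t) • A + t • B := by module
  rw [h]
  rcases ht.1.eq_or_lt with rfl | h0
  · simpa using hA
  · exact Matrix.PosDef.posSemidef_add (hA.posSemidef.smul (sub_nonneg.2 ht.2)) (hB.smul h0)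

theorem isPosDefPath_segment {n : Type*} [Fintype n] [DecidableEq n] {A B : Matrix n n ℂ}
    (hA : A.PosDef) (hB : B.PosDef) : IsPosDefPath A B 0 1 fun t => A + t • (B - A) where
  lt := one_pos
  posDef _ ht := hA.lineMap hB ht
  differentiableOn := by
    let _ : NormedAddCommGroup (Matrix n n ℂ) := Matrix.normedAddCommGroup
    let _ : NormedSpace ℝ (Matrix n n ℂ) := Matrix.normedSpace
    exact (((differentiable_id (𝕜 := ℝ) (E := ℝ)).smul_const (B - A)).const_add A).differentiableOn
  source := by simp
  target := by simp

theorem derivWithin_segment {n : Type*} [Fintype n] (A Y : Matrix n n ℂ)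
    {t : ℝ} (ht : t ∈ Set.Icc (0 : ℝ) 1) :
    derivWithin (fun t : ℝ => A + t • Y) (Set.Icc 0 1) t = Y := by
  let _ : NormedAddCommGroup (Matrix n n ℂ) := Matrix.normedAddCommGroup
  let _ : NormedSpace ℝ (Matrix n n ℂ) := Matrix.normedSpace
  have := (((hasDerivAt_id t).smul_const Y).const_add A).hasDerivWithinAt (s := Set.Icc 0 1)
  rw [one_smul] at this
  exact this.derivWithin (uniqueDiffOn_Icc_zero_one t ht)

theorem traceLength_segment_lt_top {n : Type*} [Fintype n] [DecidableEq n] {A B : Matrix n n ℂ}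
    (hA : A.PosDef) (hB : B.PosDef) : traceLength 0 1 (fun t => A + t • (B - A)) < ∞ := by
  have hcont : ContinuousOn (fun t : ℝ => ((A + t • (B - A))⁻¹).trace.re) (Set.Icc 0 1) := by
    have hγ : Continuous fun t : ℝ => A + t • (B - A) := by fun_prop
    have : ContinuousOn (fun t : ℝ => (A + t • (B - A))⁻¹) (Set.Icc 0 1) := by
      intro t ht
      have hdet : (A + t • (B - A)).det ≠ 0 :=
        ((Matrix.isUnit_iff_isUnit_det _).1 (hA.lineMap hB ht).isUnit).ne_zero
      simp only [Matrix.inv_def, Ring.inverse_eq_inv']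
      exact ((hγ.matrix_det.continuousAt.inv₀ hdet).smul
        hγ.matrix_adjugate.continuousAt).continuousWithinAt
    exact Complex.continuous_re.comp_continuousOn
      ((continuous_id.matrix_trace).comp_continuousOn this)
  obtain ⟨C, hC⟩ := isCompact_Icc.bddAbove_image hcont
  have hbound (t : ℝ) (ht : t ∈ Set.Icc (0 : ℝ) 1) :
      traceSpeed (A + t • (B - A)) (derivWithin (fun t => A + t • (B - A)) (Set.Icc 0 1) t)
        ≤ C * frobeniusNorm (B - A) := by
    rw [derivWithin_segment A (B - A) ht]
    refine (traceSpeed_le (hA.lineMap hB ht) _).trans ?_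
    gcongr
    · exact frobeniusNorm_nonneg _
    · exact hC (Set.mem_image_of_mem _ ht)
  refine (MeasureTheory.setLIntegral_mono' measurableSet_Icc
    fun t ht => ENNReal.ofReal_le_ofReal (hbound t ht)).trans_lt ?_
  simp

/-- `toReal` sends `∞` to `0`, so a bound on all lengths passes to the distance only because the
segment has finite length. -/
theorem le_traceDist {n : Type*} [Fintype n] [DecidableEq n] {A B : Matrix n n ℂ}
    (hA : A.PosDef) (hB : B.PosDef) {c : ℝ}
    (h : ∀ a b γ, IsPosDefPath A B a b γ → ENNReal.ofReal c ≤ traceLength a b γ) :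
    c ≤ traceDist A B := by
  refine (ENNReal.ofReal_le_iff_le_toReal (ne_top_of_le_ne_top
    (traceLength_segment_lt_top hA hB).ne ?_)).1 ?_
  · exact iInf₂_le_of_le 0 1 (iInf₂_le_of_le _ (isPosDefPath_segment hA hB) le_rfl)
  · exact le_iInf₂ fun a b => le_iInf₂ fun γ hγ => h a b γ hγ

theorem log_quadForm_sub_le_traceDist {n : Type*} [Fintype n] [DecidableEq n]
    {A B : Matrix n n ℂ} (hA : A.PosDef) (hB : B.PosDef) {x y : n → ℂ} (hx : x ≠ 0)
    (hy : y ≠ 0) :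
    ((Real.log (star x ⬝ᵥ B.mulVec x).re - Real.log (star y ⬝ᵥ B.mulVec y).re)
        - (Real.log (star x ⬝ᵥ A.mulVec x).re - Real.log (star y ⬝ᵥ A.mulVec y).re))
      ≤ √2 * traceDist A B := by
  rw [← div_le_iff₀' (by positivity)]
  refine le_traceDist hA hB fun a b γ hγ => ?_
  rw [ENNReal.ofReal_div_of_pos (by positivity)]
  exact ENNReal.div_le_of_le_mul' (hγ.log_quadForm_sub_le hx hy)

/-- The logarithms of two generalized eigenvalues of `B` with respect to `A` differ by at most
`√2` times the distance from `A` to `B`. -/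
theorem log_eigenvalue_sub_le_traceDist {n : Type*} [Fintype n] [DecidableEq n]
    {A B : Matrix n n ℂ} (hA : A.PosDef) (hB : B.PosDef) {l m : ℝ} (hl : 0 < l) (hm : 0 < m)
    (hdl : (B - (l : ℂ) • A).det = 0) (hdm : (B - (m : ℂ) • A).det = 0) :
    Real.log l - Real.log m ≤ √2 * traceDist A B := by
  have hlog {k : ℝ} (hk : 0 < k) {x : n → ℂ} (hx : x ≠ 0)
      (hkx : (B - (k : ℂ) • A).mulVec x = 0) :
      Real.log (star x ⬝ᵥ B.mulVec x).re = Real.log k + Real.log (star x ⬝ᵥ A.mulVec x).re := by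
    rw [Matrix.sub_mulVec, sub_eq_zero, Matrix.smul_mulVec] at hkx
    rw [hkx, dotProduct_smul, smul_eq_mul, Complex.re_ofReal_mul,
      Real.log_mul hk.ne' (hA.re_quadForm_pos hx).ne']
  obtain ⟨x, hx, hlx⟩ := Matrix.exists_mulVec_eq_zero_iff.2 hdl
  obtain ⟨y, hy, hmy⟩ := Matrix.exists_mulVec_eq_zero_iff.2 hdm
  have h := log_quadForm_sub_le_traceDist hA hB hx hy
  rw [hlog hl hx hlx, hlog hm hy hmy] at h
  linarith

/-! ### Qubits and Einstein addition -/

/-- The determinant is a quarter of the Minkowski form `t² - ‖x‖²` at `t = 1 - l`, `x = v - l u`. -/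
theorem det_qubit_sub_smul (u v : E3) (l : ℝ) :
    (qubit v - (l : ℂ) • qubit u).det =
      (((1 - ‖u‖ ^ 2) * l ^ 2 - 2 * (1 - inner ℝ u v) * l + (1 - ‖v‖ ^ 2)) / 4 : ℝ) := by
  rw [EuclideanSpace.norm_sq_eq, EuclideanSpace.norm_sq_eq, PiLp.inner_apply,
    Matrix.det_fin_two]
  simp only [qubit, Fin.sum_univ_three, Matrix.sub_apply, Matrix.smul_apply, smul_eq_mul,
    Matrix.of_apply, Matrix.cons_val', Matrix.cons_val_zero, Matrix.cons_val_one,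
    Matrix.cons_val_fin_one, Real.norm_eq_abs, sq_abs, RCLike.inner_apply, conj_trivial]
  push_cast
  linear_combination ((l * u 1 - v 1) ^ 2 / 4 : ℂ) * Complex.I_sq

theorem qubit_posDef {u : E3} (hu : ‖u‖ < 1) : (qubit u).PosDef := by
  have hherm : (qubit u).IsHermitian := by
    ext i j
    fin_cases i <;> fin_cases j <;>
      simp [qubit, Matrix.conjTranspose_apply, Complex.conj_ofReal, sub_eq_add_neg]
  have hdet : (qubit u).det = ((1 - ‖u‖ ^ 2) / 4 : ℝ) := by
    simpa using det_qubit_sub_smul 0 u 0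
  have htr : (qubit u).trace = (1 : ℝ) := by
    simp [qubit, Matrix.trace_fin_two]
    ring
  rw [hherm.det_eq_prod_eigenvalues, Fin.prod_univ_two] at hdet
  rw [hherm.trace_eq_sum_eigenvalues, Fin.sum_univ_two] at htr
  have hprod := congrArg Complex.re hdet
  have hsum := congrArg Complex.re htr
  simp only [Complex.coe_algebraMap, Complex.re_mul_ofReal, Complex.add_re, Complex.ofReal_re]
    at hprod hsum
  have hpos : 0 < hherm.eigenvalues 0 * hherm.eigenvalues 1 := by
    nlinarith [norm_nonneg u]
  rw [hherm.posDef_iff_eigenvalues_pos, Fin.forall_fin_two]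
  constructor <;> by_contra! h <;> nlinarith

/-- Equivalent to the gamma identity `γ_{u ⊕ v} = γ_u γ_v (1 + uᵀv)`. -/
theorem norm_einsteinAddVec_sq {u v : E3} (hu : ‖u‖ < 1) (hv : ‖v‖ < 1) :
    ‖einsteinAddVec u v‖ ^ 2 =
      1 - (1 - ‖u‖ ^ 2) * (1 - ‖v‖ ^ 2) / (1 + inner ℝ u v) ^ 2 := by
  have h1 : 0 < 1 + inner ℝ u v := by
    nlinarith [(abs_le.mp (abs_real_inner_le_norm u v)).1, norm_nonneg u, norm_nonneg v]
  have hU : 0 < 1 - ‖u‖ ^ 2 := by nlinarith [norm_nonneg u]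
  set s := √(1 - ‖u‖ ^ 2) with hs
  have hspos : 0 < s := Real.sqrt_pos.mpr hU
  have hs2 : s ^ 2 = 1 - ‖u‖ ^ 2 := Real.sq_sqrt hU.le
  have hvec : einsteinAddVec u v =
      (1 / (1 + inner ℝ u v)) • ((1 + inner ℝ u v / (1 + s)) • u + s • v) := by
    have e1 : lorentzFactor u = 1 / s := rfl
    have e2 : lorentzFactor u / (1 + lorentzFactor u) * inner ℝ u v
        = inner ℝ u v / (1 + s) := by
      rw [e1]
      field_simp
      ring
    rw [einsteinAddVec, e2, e1, one_div_one_div]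
    module
  have hn : ‖(1 + inner ℝ u v / (1 + s)) • u + s • v‖ ^ 2
      = (1 + inner ℝ u v) ^ 2 - (1 - ‖u‖ ^ 2) * (1 - ‖v‖ ^ 2) := by
    rw [norm_add_sq_real, norm_smul, norm_smul, inner_smul_left, inner_smul_right,
      mul_pow, mul_pow, Real.norm_eq_abs, Real.norm_eq_abs, sq_abs, sq_abs]
    have : ‖u‖ ^ 2 = 1 - s ^ 2 := by linarith
    rw [this]
    simp only [conj_trivial]
    field_simp
    ring
  rw [hvec, norm_smul, mul_pow, hn, Real.norm_eq_abs, sq_abs]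
  field_simp

theorem theoremT (u v : UnitBall3) :
    rapidityDist u v ≤ 1 / √2 * traceDist (qubit u) (qubit v) := by
  have hu : ‖(u : E3)‖ < 1 := mem_ball_zero_iff.1 u.2
  have hv : ‖(v : E3)‖ < 1 := mem_ball_zero_iff.1 v.2
  have hr1 : ‖(einsteinAdd (-u) v : E3)‖ < 1 := mem_ball_zero_iff.1 (einsteinAdd (-u) v).2
  have hr := norm_einsteinAddVec_sq (u := -(u : E3)) (by rwa [norm_neg]) hv
  change ‖(einsteinAdd (-u) v : E3)‖ ^ 2 = _ at hr
  rw [norm_neg, inner_neg_left, ← sub_eq_add_neg] at hr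
  unfold rapidityDist
  have hr0 := norm_nonneg (einsteinAdd (-u) v : E3)
  set r := ‖(einsteinAdd (-u) v : E3)‖
  have hc : 0 < 1 - inner ℝ (u : E3) v := by
    nlinarith [(abs_le.mp (abs_real_inner_le_norm (u : E3) v)).2, norm_nonneg (u : E3),
      norm_nonneg (v : E3)]
  have hU : 0 < 1 - ‖(u : E3)‖ ^ 2 := by nlinarith [norm_nonneg (u : E3)]
  set c := 1 - inner ℝ (u : E3) v with hcdef
  set U := 1 - ‖(u : E3)‖ ^ 2 with hUdef
  set V := 1 - ‖(v : E3)‖ ^ 2 with hVdef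
  have hUV : U * V = c ^ 2 * (1 - r ^ 2) := by
    rw [hr]; field_simp; ring
  -- The quadratic `U l² - 2 c l + V` has reduced discriminant `c² - U V = c² r²`, hence roots `c (1
  -- ± r) / U`.
  have hdet (e : ℝ) (he : e ^ 2 = r ^ 2) :
      (qubit v - ((c * (1 + e) / U : ℝ) : ℂ) • qubit u).det = 0 := by
    rw [det_qubit_sub_smul, ← hcdef, ← hUdef, ← hVdef, Complex.ofReal_eq_zero]
    field_simp
    linear_combination hUV + c ^ 2 * he
  have h := log_eigenvalue_sub_le_traceDist (qubit_posDef hu) (qubit_posDef hv)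
    (l := c * (1 + r) / U) (m := c * (1 + -r) / U)
    (by positivity) (div_pos (mul_pos hc (by linarith)) hU) (hdet r rfl) (hdet (-r) (neg_sq r))
  have hp : (0 : ℝ) < 1 + r := by linarith
  have hm : (0 : ℝ) < 1 + -r := by linarith
  rw [← Real.log_div (by positivity) (by positivity),
    show c * (1 + r) / U / (c * (1 + -r) / U) = (1 + r) / (1 - r) by
      rw [← sub_eq_add_neg] at hm ⊢; field_simp] at h
  rw [Real.artanh_eq_half_log ⟨by linarith, hr1.le⟩]
  have h2 : (1 : ℝ) / √2 = 1 / 2 * √2 := by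
    field_simp; norm_num
  rw [h2, mul_assoc]
  linarith
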